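/- **Cell complexes.** A *cell complex* $K=(X,\delta,m)$ consists of a finite set $X=\dot\bigcup_{k\ge 0}X_k$ of cells (write $\dim z=k$ iff $z\in X_k$), a linear operator $\delta:C(X)\to C(X)$ on $C(X)=\mathbb R^X$, and a weight $m:X\to(0,\infty)$. A cell $x$ is identified with its indicator function $1_x\in C(X)$, and $x\lessdot z$ means $\delta x(z)\neq 0$. It is required that, for all $v,z,z'\in X$: * $\delta v(z)\in\{-1,0,1\}$; $\delta v(z)=0$ unless $\dim z=\dim v+1$; and if $\dim z\ge 1$ there is some $x\lessdot z$; * (i) for every $x\in X_1$ there is exactly one $w\in X_0$ with $\delta w(x)=1$ and exactly one $w\in X_0$ with $\delta w(x)=-1$; * (ii) if $\dim z=\dim v+2$ and $\{x:v\lessdot x\lessdot z\}\ne\emptyset$, then this set has exactly two elements and $\{\delta v(x)\,\delta x(z):x\in X\}\supseteq\{-1,1\}$; * (iii) if $\dim z\ge 2$, any two $x,y\lessdot z$ are joined by a sequence $x=x_0,\dots,x_n=y$ of proper faces of $z$ with $\delta x_j(x_{j-1})+\delta x_{j-1}(x_j)\ne 0$ for $j=1,\dots,n$ (a proper face of $z$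 is a cell $a$ with $a\lessdot\dots\lessdot z$, a chain of length at least one); * (iv) if $\dim z\ge1$ and $\{x:x\lessdot z\}=\{x:x\lessdot z'\}$, then $z=z'$. The dimension of $K$ is the maximal dimension of its cells. The $k$-skeleton of $K$ is $\bigcup_{j\le k}X_j$ with the restrictions of $\delta$ and $m$. A 1-dimensional cell complex is the same as a finite weighted simple graph with at least one edge. **Curvatures.** Let $\delta^*$ be the adjoint of $\delta$ with respect to $\langle f,g\rangle=\sum_{x\in X} f(x)g(x)m(x)$, and let $H=\delta\delta^*+\delta^*\delta$. The Forman curvature of a cell $x$ of $K$ is $$F_K(x)=Hx(x)-\sum_{y\neq x}|Hy(x)|,$$ and the Ollivier curvature of a cell $x$ is $$\kappa(x)=\inf\{\,\delta\delta^*\delta f(x)\;:\; f\in C(X),\ \delta f(x)=1,\ |\delta f|\le 1\,\}.$$ **Theorem.** Let $G=(X,\delta,m)$ be a 1-dimensional cell complex and let $x\in X_1$ be an edge. Then $$\kappa(x)=\max_K F_K(x),$$ where $\kappa$ is the Ollivier curvature of $G$ and the maximum (which is attained) is taken over all cell complexes $K$ having $G$ as 1-skeleton. The same holds when $K$ ranges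 only over the cell complexes of dimension at most $2$ having $G$ as 1-skeleton. -/

import Mathlib

universe u

/-- The data `(X, δ, m)` of a cell complex: a finite set of cells graded by dimension
(`X_k = {x | dim x = k}`), a linear operator `δ` on `C(X) = ℝ^X`, and a weight `m`. -/
structure CellData where
  /-- the set of cells -/
  Cell : Type u
  [fintypeCell : Fintype Cell]
  [decEqCell : DecidableEq Cell]
  /-- the dimension of a cell -/
  dim : Cell → ℕ
  /-- the coboundary operator -/
  δ : (Cell → ℝ) →ₗ[ℝ] (Cell → ℝ)
  /-- the weight -/
  m : Cell → ℝ

attribute [instance] CellData.fintypeCell CellData.decEqCell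

namespace CellData

variable (K : CellData.{u})

/-- `δ v (z)`, where the cell `v` is identified with its indicator function. -/
noncomputable def inc (v z : K.Cell) : ℝ := K.δ (Pi.single v 1) z

/-- `x ⋖ z`, i.e. `δ x (z) ≠ 0`. -/
def Facet (x z : K.Cell) : Prop := K.inc x z ≠ 0

/-- `a` is a proper face of `z`: there is a chain `a ⋖ … ⋖ z` of length at least one. -/
def ProperFace (a z : K.Cell) : Prop := Relation.TransGen K.Facet a z

/-- `a` and `b` are proper faces of `z`, and one of them is a facet of the other. -/
def BoundaryAdj (z a b : K.Cell) : Prop :=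
  K.ProperFace a z ∧ K.ProperFace b z ∧ K.inc a b + K.inc b a ≠ 0

/-- The dimension of the complex, the maximum of the dimensions of its cells. -/
def dimension : ℕ := Finset.univ.sup K.dim

/-- The scalar product `⟨f, g⟩ = ∑ f(x) g(x) m(x)`. -/
noncomputable def scal (f g : K.Cell → ℝ) : ℝ := ∑ x, f x * g x * K.m x

/-- The adjoint `δ*` of `δ` with respect to `scal`, see `scal_δ_eq`. -/
noncomputable def δadj : (K.Cell → ℝ) →ₗ[ℝ] (K.Cell → ℝ) where
  toFun f x := ∑ z, f z * (K.m z / K.m x) * K.inc x z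
  map_add' f g := by
    funext x
    simp only [Pi.add_apply, add_mul, Finset.sum_add_distrib]
  map_smul' c f := by
    funext x
    simp only [Pi.smul_apply, smul_eq_mul, RingHom.id_apply, Finset.mul_sum, mul_assoc]

/-- The Hodge Laplacian `H = δ δ* + δ* δ`. -/
noncomputable def hodge : (K.Cell → ℝ) →ₗ[ℝ] (K.Cell → ℝ) :=
  K.δ ∘ₗ K.δadj + K.δadj ∘ₗ K.δ

/-- The Forman curvature `F(x) = H x (x) - ∑_{y ≠ x} |H y (x)|`. -/
noncomputable def forman (x : K.Cell) : ℝ :=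
  K.hodge (Pi.single x 1) x - ∑ y ∈ Finset.univ.erase x, |K.hodge (Pi.single y 1) x|

/-- The Ollivier curvature `κ(x)`, the infimum of `δ δ* δ f (x)` over all `f ∈ C(X)` with
`δ f (x) = 1` and `|δ f| ≤ 1`. The infimum is taken in the extended reals (over the empty
set it is `⊤`). -/
noncomputable def ollivier (x : K.Cell) : EReal :=
  sInf {r : EReal | ∃ f : K.Cell → ℝ, K.δ f x = 1 ∧ (∀ y, |K.δ f y| ≤ 1) ∧
    r = ((K.δ (K.δadj (K.δ f)) x : ℝ) : EReal)}

end CellData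

/-- A (weighted, finite, combinatorial) cell complex. -/
structure CellComplex extends CellData.{u} where
  m_pos : ∀ x, 0 < toCellData.m x
  inc_mem : ∀ v z, toCellData.inc v z = -1 ∨ toCellData.inc v z = 0 ∨ toCellData.inc v z = 1
  dim_of_facet : ∀ v z, toCellData.Facet v z → toCellData.dim z = toCellData.dim v + 1
  exists_facet : ∀ z, 1 ≤ toCellData.dim z → ∃ x, toCellData.Facet x z
  /-- An edge has exactly one vertex with sign `1` and exactly one with sign `-1`. -/
  edge : ∀ x, toCellData.dim x = 1 →
    {w | toCellData.dim w = 0 ∧ toCellData.inc w x = 1}.ncard = 1 ∧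
    {w | toCellData.dim w = 0 ∧ toCellData.inc w x = -1}.ncard = 1
  /-- The diamond property, and the two signs. -/
  diamond : ∀ v z, toCellData.dim z = toCellData.dim v + 2 →
    {x | toCellData.Facet v x ∧ toCellData.Facet x z}.Nonempty →
    {x | toCellData.Facet v x ∧ toCellData.Facet x z}.ncard = 2 ∧
    ({-1, 1} : Set ℝ) ⊆ {r | ∃ x, r = toCellData.inc v x * toCellData.inc x z}
  /-- The boundary of a cell of dimension at least two is connected: any two of its facets are
  joined by a sequence of successively incident proper faces. -/
  connected : ∀ z, 2 ≤ toCellData.dim z → ∀ x y, toCellData.Facet x z → toCellData.Facet y z →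
    Relation.ReflTransGen (toCellData.BoundaryAdj z) x y
  /-- A cell of positive dimension is determined by its facets. -/
  eq_of_facets : ∀ z z', 1 ≤ toCellData.dim z →
    {x | toCellData.Facet x z} = {x | toCellData.Facet x z'} → z = z'

namespace CellComplex

/-- `δadj` is the adjoint of `δ`. -/
theorem scal_δ_eq (K : CellComplex.{u}) (f g : K.Cell → ℝ) :
    K.scal (K.δ f) g = K.scal f (K.δadj g) := by
  have h : ∀ z, K.δ f z = ∑ x, f x * K.inc x z := by
    intro z
    have hf : f = ∑ x, f x • (Pi.single x (1 : ℝ) : K.Cell → ℝ) := by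
      funext y
      simp [Finset.sum_apply, Pi.single_apply]
    conv_lhs => rw [hf]
    simp [map_sum, map_smul, Finset.sum_apply, CellData.inc]
  simp only [CellData.scal, CellData.δadj, LinearMap.coe_mk, AddHom.coe_mk, h,
    Finset.sum_mul, Finset.mul_sum]
  rw [Finset.sum_comm]
  refine Finset.sum_congr rfl fun x _ => Finset.sum_congr rfl fun z _ => ?_
  have := (K.m_pos x).ne'
  field_simp

/-- `ι` identifies `G` with the `k`-skeleton of `K`: it is a bijection of the cells of `G` onto
the cells of `K` of dimension at most `k`, under which the dimension, the coboundary and the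
weight of `G` are the restrictions of those of `K`. -/
structure IsSkeleton (k : ℕ) (G K : CellComplex.{u}) (ι : G.Cell → K.Cell) : Prop where
  injective : Function.Injective ι
  range_eq : Set.range ι = {z | K.dim z ≤ k}
  dim_eq : ∀ x, K.dim (ι x) = G.dim x
  inc_eq : ∀ x y, K.inc (ι x) (ι y) = G.inc x y
  m_eq : ∀ x, K.m (ι x) = G.m x

end CellComplex

/-! Forman curvature is itself a minimum: `F_K(x)` is the least value of `H h (x)` over all `h` with
`h x = 1` and `|h| ≤ 1`. If `h = δ f` with `f` supported on vertices, then `δ δ = 0` turns `H h (x)`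
into `δ δ* δ f (x)`, which involves only `G`. Hence `F_K(x) ≤ κ(x)` for every `K`
(`forman_le_ollivier`).

For equality, minimize `A g = δ δ* g (x)` over edge functions `g` with `g x = 1`, `|g| ≤ 1` and
circulation at most zero along every oriented cycle through `x`. Lagrange multipliers `w c ≥ 0` for
the cycle constraints (`exists_lagrange_multipliers`) give `A g ≤ A h + ∑ w c * ⟨c, h⟩` for all
admissible `h`, where `⟨c, h⟩` is the circulation. Attaching a disc of weight `w c * m x` along each
cycle with `w c > 0` adds exactly this sum to the Hodge Laplacian at `x` (`hodge_attach_inl`), so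
the resulting 2-dimensional complex has `F(x) ≥ A g`.

It remains to see that `κ(x) ≤ A g`. The value `A g` depends only on the edges at the two ends of
`x`, and the circulation conditions for cycles of length at most five suffice to build a 1-Lipschitz
`f` with `δ δ* δ f (x) ≤ A g` (`exists_lipschitz_of_circulation_nonpos`, `exists_δ_dominated`). -/

namespace SimpleGraph

/-! ### Lipschitz functions from circulation bounds on short cycles. -/

variable {V : Type*} (Γ : SimpleGraph V)

open Classical in
/-- The graph distance, truncated at `3`. -/
noncomputable def truncDist (u v : V) : ℝ :=
  if u = v then 0 else if Γ.Adj u v then 1 else if ∃ t, Γ.Adj u t ∧ Γ.Adj t v then 2 else 3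

theorem truncDist_self (u : V) : Γ.truncDist u u = 0 := by simp [truncDist]

variable {Γ} in
theorem Adj.truncDist_eq {u v : V} (h : Γ.Adj u v) : Γ.truncDist u v = 1 := by
  simp [truncDist, h, h.ne]

variable {Γ} in
theorem Adj.truncDist_le {v v' : V} (h : Γ.Adj v v') (u : V) :
    Γ.truncDist u v' ≤ Γ.truncDist u v + 1 := by
  by_cases h0 : u = v
  · subst h0
    simp [truncDist_self, h.truncDist_eq]
  by_cases h1 : Γ.Adj u v
  · have h2 : ∃ t, Γ.Adj u t ∧ Γ.Adj t v' := ⟨v, h1, h⟩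
    rw [h1.truncDist_eq]
    unfold truncDist
    split_ifs <;> norm_num
  · have h2 : 2 ≤ Γ.truncDist u v := by
      unfold truncDist
      rw [if_neg h0, if_neg h1]
      split_ifs <;> norm_num
    have h3 : Γ.truncDist u v' ≤ 3 := by
      unfold truncDist
      split_ifs <;> norm_num
    linarith

/-- The four possible reasons for a value of the truncated distance. -/
theorem truncDist_cases (u v : V) : u = v ∨ (Γ.Adj u v ∧ Γ.truncDist u v = 1) ∨
    (u ≠ v ∧ (∃ t, Γ.Adj u t ∧ Γ.Adj t v) ∧ Γ.truncDist u v = 2) ∨ Γ.truncDist u v = 3 := by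
  by_cases h0 : u = v
  · exact Or.inl h0
  by_cases h1 : Γ.Adj u v
  · exact Or.inr (Or.inl ⟨h1, h1.truncDist_eq⟩)
  by_cases h2 : ∃ t, Γ.Adj u t ∧ Γ.Adj t v
  · exact Or.inr (Or.inr (Or.inl ⟨h0, h2, by simp only [truncDist, if_neg h0, if_neg h1, if_pos h2]⟩))
  · exact Or.inr (Or.inr (Or.inr (by simp only [truncDist, if_neg h0, if_neg h1, if_neg h2])))

/-- An antisymmetric function `g` on the oriented edges, bounded by `1`, with `g x₀ x₁ = 1` and
nonpositive circulation along the cycles of length at most five through `x₀ x₁`, is dominated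
around `x₀` and `x₁` by the gradient of a `1`-Lipschitz function. -/
theorem exists_lipschitz_of_circulation_nonpos [Fintype V] (g : V → V → ℝ)
    (hanti : ∀ u v, g v u = -g u v) (hle : ∀ u v, g u v ≤ 1) {x₀ x₁ : V}
    (hx : Γ.Adj x₀ x₁) (hg : g x₀ x₁ = 1)
    (h3 : ∀ u, Γ.Adj x₁ u → Γ.Adj u x₀ → g x₀ x₁ + g x₁ u + g u x₀ ≤ 0)
    (h4 : ∀ u w, u ≠ x₀ → w ≠ x₁ → Γ.Adj x₁ u → Γ.Adj u w → Γ.Adj w x₀ →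
      g x₀ x₁ + g x₁ u + g u w + g w x₀ ≤ 0)
    (h5 : ∀ u t w, u ≠ x₀ → w ≠ x₁ → u ≠ w → t ≠ x₀ → t ≠ x₁ →
      Γ.Adj x₁ u → Γ.Adj u t → Γ.Adj t w → Γ.Adj w x₀ →
      g x₀ x₁ + g x₁ u + g u t + g t w + g w x₀ ≤ 0) :
    ∃ f : V → ℝ, f x₀ = 0 ∧ f x₁ = 1 ∧ (∀ v v', Γ.Adj v v' → f v - f v' ≤ 1) ∧
      (∀ u, Γ.Adj x₁ u → 1 + g x₁ u ≤ f u) ∧ (∀ w, Γ.Adj x₀ w → f w ≤ g x₀ w) := by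
  classical
  have hself : ∀ u, g u u = 0 := fun u => by linarith [hanti u u]
  have hge : ∀ u v, -1 ≤ g u v := fun u v => by linarith [hanti u v, hle v u]
  have hg' : g x₁ x₀ = -1 := by rw [hanti x₀ x₁, hg]
  let I : Finset V := Finset.univ.filter fun u => u = x₁ ∨ Γ.Adj x₁ u
  have hI : ∀ u, u ∈ I ↔ u = x₁ ∨ Γ.Adj x₁ u := fun u => by simp [I]
  have hIne : I.Nonempty := ⟨x₁, by simp [I]⟩
  -- A McShane-type extension of the required lower bounds on the closed neighbourhood of `x₁`.
  -- Lipschitz continuity and the bounds at neighbours of `x₁` are then immediate; the cycle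
  -- hypotheses serve to bound `f` from above at `x₀` and its neighbours.
  let f : V → ℝ := fun v => I.sup' hIne fun u => 1 + g x₁ u - Γ.truncDist u v
  have hlow : ∀ u v, (u = x₁ ∨ Γ.Adj x₁ u) → 1 + g x₁ u - Γ.truncDist u v ≤ f v := fun u v hu =>
    Finset.le_sup' (fun u => 1 + g x₁ u - Γ.truncDist u v) ((hI u).2 hu)
  have hupp : ∀ v c, 1 - Γ.truncDist x₁ v ≤ c →
      (∀ u, Γ.Adj x₁ u → 1 + g x₁ u - Γ.truncDist u v ≤ c) → f v ≤ c := by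
    intro v c h1 h2
    refine Finset.sup'_le _ _ fun u hu => ?_
    rcases (hI u).1 hu with rfl | hu
    · rw [hself]; linarith
    · exact h2 u hu
  refine ⟨f, le_antisymm (hupp _ _ ?_ ?_) ?_, le_antisymm (hupp _ _ ?_ ?_) ?_, ?_, ?_, ?_⟩
  · rw [hx.symm.truncDist_eq]; norm_num
  · intro u hu
    rcases Γ.truncDist_cases u x₀ with rfl | ⟨ha, hd⟩ | ⟨-, -, hd⟩ | hd
    · rw [hg', truncDist_self]; norm_num
    · rw [hd]; linarith [h3 u hu ha, hge u x₀, hle x₀ u, hanti x₀ u]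
    · rw [hd]; linarith [hle x₁ u]
    · rw [hd]; linarith [hle x₁ u]
  · have := hlow x₁ x₀ (Or.inl rfl)
    rw [hself, hx.symm.truncDist_eq] at this
    linarith
  · rw [truncDist_self]; norm_num
  · intro u hu
    rw [hu.symm.truncDist_eq]; linarith [hle x₁ u]
  · have := hlow x₁ x₁ (Or.inl rfl)
    rw [hself, truncDist_self] at this
    linarith
  · intro v v' h
    have : f v ≤ f v' + 1 := by
      refine Finset.sup'_le _ _ fun u hu => ?_
      have h1 := hlow u v' ((hI u).1 hu)
      have h2 := h.truncDist_le u
      linarith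
    linarith
  · intro u hu
    have := hlow u u (Or.inr hu)
    rw [truncDist_self] at this
    linarith
  · intro w hw
    by_cases hw1 : w = x₁
    · subst hw1
      refine hupp _ _ ?_ fun u hu => ?_
      · rw [truncDist_self, hg]; norm_num
      · rw [hu.symm.truncDist_eq, hg]; linarith [hle w u]
    have htri : Γ.Adj x₁ w → 1 + g x₁ w ≤ g x₀ w := fun h => by
      linarith [h3 w h hw.symm, hanti x₀ w]
    refine hupp _ _ ?_ fun u hu => ?_
    · rcases Γ.truncDist_cases x₁ w with h | ⟨ha, hd⟩ | ⟨-, -, hd⟩ | hd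
      · exact absurd h.symm hw1
      · rw [hd]; linarith [htri ha, hge x₁ w]
      · rw [hd]; linarith [hge x₀ w]
      · rw [hd]; linarith [hge x₀ w]
    · by_cases hu0 : u = x₀
      · subst hu0
        rw [hg', hw.truncDist_eq]; linarith [hge u w]
      rcases Γ.truncDist_cases u w with rfl | ⟨ha, hd⟩ | ⟨hne, ⟨t, hut, htw⟩, hd⟩ | hd
      · rw [truncDist_self]; linarith [htri hu]
      · rw [hd]; linarith [h4 u w hu0 hw1 hu ha hw.symm, hge u w, hanti x₀ w]
      · rw [hd]
        -- The closed walk `x₀ x₁ u t w` is a genuine 5-cycle only if `t` avoids `x₀` and `x₁`; in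
        -- the two degenerate cases a triangle through the edge suffices.
        by_cases ht0 : t = x₀
        · subst ht0
          linarith [h3 u hu hut, hanti t u, hle t u, hge t w]
        by_cases ht1 : t = x₁
        · subst ht1
          linarith [htri htw, hge t w, hle t u]
        linarith [h5 u t w hu0 hw1 hne ht0 ht1 hu hut htw hw.symm, hge u t, hge t w, hanti x₀ w]
      -- Since `1 + 1 - 3 = -1` is a lower bound for `g`, distance three needs no cycle condition;
      -- this is why the truncation at `3` and cycles up to length five are enough.
      · rw [hd]; linarith [hle x₁ u, hge x₀ w]

end SimpleGraph

/-! ### Sums with exactly two nonzero, opposite terms. -/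

/-- A function on a finite type with exactly two nonzero values, which are `-1` and `1`. -/
theorem add_eq_zero_of_ncard_eq_two {α : Type*} {p : α → ℝ} {s : Set α}
    (hs : ∀ x, x ∈ s ↔ p x ≠ 0) (hcard : s.ncard = 2)
    (hsub : ({-1, 1} : Set ℝ) ⊆ {r | ∃ x, r = p x}) {a b : α} (hab : a ≠ b) (ha : p a ≠ 0)
    (hb : p b ≠ 0) : (∀ x, p x ≠ 0 → x = a ∨ x = b) ∧ p a + p b = 0 := by
  have hset : ({a, b} : Set α) = s := by
    refine Set.eq_of_subset_of_ncard_le ?_ ?_ (Set.finite_of_ncard_ne_zero (by omega))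
    · rintro x (rfl | rfl)
      exacts [(hs _).2 ha, (hs _).2 hb]
    · rw [hcard, Set.ncard_pair hab]
  have hmem : ∀ x, p x ≠ 0 → x = a ∨ x = b := fun x hx => by
    have := (hs x).2 hx
    rwa [← hset] at this
  refine ⟨hmem, ?_⟩
  obtain ⟨q, hq⟩ := hsub (Set.mem_insert (-1) _)
  obtain ⟨r, hr⟩ := hsub (Set.mem_insert_of_mem (-1) rfl)
  have hq' := hmem q (by rw [← hq]; norm_num)
  have hr' := hmem r (by rw [← hr]; norm_num)
  rcases hq' with rfl | rfl <;> rcases hr' with rfl | rfl <;> linarith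

theorem sum_eq_zero_of_ncard_eq_two {α : Type*} [Fintype α] {p : α → ℝ} {s : Set α}
    (hs : ∀ x, x ∈ s ↔ p x ≠ 0) (hcard : s.ncard = 2)
    (hsub : ({-1, 1} : Set ℝ) ⊆ {r | ∃ x, r = p x}) : ∑ x, p x = 0 := by
  classical
  obtain ⟨a, b, hab, hset⟩ := Set.ncard_eq_two.1 hcard
  obtain ⟨hmem, h0⟩ := add_eq_zero_of_ncard_eq_two hs hcard hsub hab
    ((hs a).1 (by simp [hset])) ((hs b).1 (by simp [hset]))
  rw [← h0, ← Finset.sum_pair hab]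
  refine (Finset.sum_subset (Finset.subset_univ _) fun x _ hx => ?_).symm
  by_contra hne
  exact hx (by simpa using hmem x hne)

/-! ### Matrix entries of the operators, and Forman curvature as a minimum. -/

namespace CellData

variable (K : CellData.{u})

theorem apply_eq_sum_single (T : (K.Cell → ℝ) →ₗ[ℝ] (K.Cell → ℝ)) (f : K.Cell → ℝ) (z : K.Cell) :
    T f z = ∑ y, f y * T (Pi.single y 1) z := by
  have hf : f = ∑ y, f y • (Pi.single y (1 : ℝ) : K.Cell → ℝ) := by
    funext y
    simp [Finset.sum_apply, Pi.single_apply]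
  conv_lhs => rw [hf]
  simp [map_sum, map_smul, Finset.sum_apply]

theorem δ_apply (f : K.Cell → ℝ) (z : K.Cell) : K.δ f z = ∑ v, f v * K.inc v z :=
  K.apply_eq_sum_single K.δ f z

theorem δadj_apply (f : K.Cell → ℝ) (v : K.Cell) :
    K.δadj f v = ∑ z, f z * (K.m z / K.m v) * K.inc v z := rfl

theorem hodge_single (x y : K.Cell) :
    K.hodge (Pi.single y 1) x = K.δ (K.δadj (Pi.single y 1)) x +
      ∑ z, K.inc y z * (K.m z / K.m x) * K.inc x z := rfl

theorem δ_δadj_single (x y : K.Cell) :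
    K.δ (K.δadj (Pi.single y 1)) x = ∑ v, K.m y / K.m v * K.inc v y * K.inc v x := by
  rw [δ_apply]
  refine Finset.sum_congr rfl fun v _ => ?_
  rw [δadj_apply, Finset.sum_eq_single y]
  · simp
  · intro z _ hz
    simp [hz]
  · simp

/-- Each cell `y ≠ x` contributes `h y * H y (x) ≥ -|H y (x)|`; the next lemma attains equality by
choosing signs. -/
theorem forman_le_hodge (x : K.Cell) (h : K.Cell → ℝ) (hx : h x = 1) (hle : ∀ y, |h y| ≤ 1) :
    K.forman x ≤ K.hodge h x := by
  rw [K.apply_eq_sum_single K.hodge h x, ← Finset.add_sum_erase _ _ (Finset.mem_univ x), hx, one_mul,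
    forman, sub_eq_add_neg, ← Finset.sum_neg_distrib]
  refine add_le_add_right (Finset.sum_le_sum fun y _ => ?_) _
  refine neg_le_of_abs_le ?_
  rw [abs_mul]
  exact mul_le_of_le_one_left (abs_nonneg _) (hle y)

theorem exists_forman_eq_hodge (x : K.Cell) :
    ∃ h : K.Cell → ℝ, h x = 1 ∧ (∀ y, |h y| ≤ 1) ∧ K.hodge h x = K.forman x := by
  refine ⟨fun y => if y = x then 1 else if 0 ≤ K.hodge (Pi.single y 1) x then -1 else 1,
    if_pos rfl, fun y => ?_, ?_⟩
  · dsimp only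
    split_ifs <;> simp
  · rw [K.apply_eq_sum_single K.hodge _ x, ← Finset.add_sum_erase _ _ (Finset.mem_univ x), if_pos rfl,
      one_mul, forman, sub_eq_add_neg, ← Finset.sum_neg_distrib]
    congr 1
    refine Finset.sum_congr rfl fun y hy => ?_
    rw [if_neg (Finset.ne_of_mem_erase hy)]
    split_ifs with h
    · rw [abs_of_nonneg h]; ring
    · rw [abs_of_neg (not_le.1 h)]; ring

end CellData

/-! ### The identity `δ δ = 0`, and edges as pairs of end points. -/

namespace CellComplex

variable (K : CellComplex.{u})

theorem abs_inc_le (v z : K.Cell) : |K.inc v z| ≤ 1 := by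
  rcases K.inc_mem v z with h | h | h <;> simp [h]

theorem inc_eq_zero_of_dim {v z : K.Cell} (h : K.dim z ≠ K.dim v + 1) : K.inc v z = 0 := by
  by_contra h0
  exact h (K.dim_of_facet v z h0)

/-- By the diamond property the nonzero terms, if any, are one `1` and one `-1`. -/
theorem sum_inc_mul_inc (v z : K.Cell) : ∑ x, K.inc v x * K.inc x z = 0 := by
  by_cases hne : {x | K.Facet v x ∧ K.Facet x z}.Nonempty
  · have hdim : K.dim z = K.dim v + 2 := by
      obtain ⟨x, h1, h2⟩ := hne
      rw [K.dim_of_facet _ _ h2, K.dim_of_facet _ _ h1]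
    obtain ⟨hcard, hsub⟩ := K.diamond v z hdim hne
    exact sum_eq_zero_of_ncard_eq_two (fun x => mul_ne_zero_iff.symm) hcard hsub
  · refine Finset.sum_eq_zero fun x _ => ?_
    by_contra h0
    exact hne ⟨x, mul_ne_zero_iff.1 h0⟩

theorem δ_δ (f : K.Cell → ℝ) : K.δ (K.δ f) = 0 := by
  funext z
  simp only [K.δ_apply, Finset.sum_mul, Pi.zero_apply]
  rw [Finset.sum_comm]
  refine Finset.sum_eq_zero fun v _ => ?_
  simp only [mul_assoc, ← Finset.mul_sum, sum_inc_mul_inc, mul_zero]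

theorem hodge_δ (f : K.Cell → ℝ) : K.hodge (K.δ f) = K.δ (K.δadj (K.δ f)) := by
  simp [CellData.hodge, K.δ_δ]

variable {K}

theorem eq_of_inc_eq {v w e : K.Cell} (he : K.dim e = 1) (hv : K.inc v e ≠ 0)
    (h : K.inc v e = K.inc w e) : v = w := by
  have hdv : K.dim v = 0 := by have := K.dim_of_facet v e hv; omega
  have hdw : K.dim w = 0 := by have := K.dim_of_facet w e (show K.inc w e ≠ 0 from h ▸ hv); omega
  obtain ⟨h1, h2⟩ := K.edge e he
  obtain ⟨a, ha⟩ := Set.ncard_eq_one.1 h1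
  obtain ⟨b, hb⟩ := Set.ncard_eq_one.1 h2
  rcases K.inc_mem v e with h' | h' | h'
  · have hv1 : v ∈ {w | K.dim w = 0 ∧ K.inc w e = -1} := ⟨hdv, h'⟩
    have hw1 : w ∈ {w | K.dim w = 0 ∧ K.inc w e = -1} := ⟨hdw, h ▸ h'⟩
    rw [hb] at hv1 hw1
    exact hv1.trans hw1.symm
  · exact absurd h' hv
  · have hv1 : v ∈ {w | K.dim w = 0 ∧ K.inc w e = 1} := ⟨hdv, h'⟩
    have hw1 : w ∈ {w | K.dim w = 0 ∧ K.inc w e = 1} := ⟨hdw, h ▸ h'⟩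
    rw [ha] at hv1 hw1
    exact hv1.trans hw1.symm

theorem exists_inc_eq_one {e : K.Cell} (he : K.dim e = 1) : ∃ v, K.inc v e = 1 := by
  obtain ⟨a, ha⟩ := Set.ncard_eq_one.1 (K.edge e he).1
  exact ⟨a, (ha ▸ Set.mem_singleton a : a ∈ {w | K.dim w = 0 ∧ K.inc w e = 1}).2⟩

theorem exists_inc_eq_neg_one {e : K.Cell} (he : K.dim e = 1) : ∃ v, K.inc v e = -1 := by
  obtain ⟨a, ha⟩ := Set.ncard_eq_one.1 (K.edge e he).2
  exact ⟨a, (ha ▸ Set.mem_singleton a : a ∈ {w | K.dim w = 0 ∧ K.inc w e = -1}).2⟩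

theorem facet_iff_of_edge {v w e : K.Cell} (he : K.dim e = 1) (hvw : K.inc v e * K.inc w e = -1)
    (a : K.Cell) : K.Facet a e ↔ a = v ∨ a = w := by
  constructor
  · intro ha
    rcases K.inc_mem v e with hv | hv | hv <;> rcases K.inc_mem w e with hw | hw | hw <;>
      rcases K.inc_mem a e with h | h | h <;> rw [hv, hw] at hvw <;> norm_num at hvw
    all_goals first
      | exact absurd h ha
      | exact Or.inl (eq_of_inc_eq he ha (h.trans hv.symm))
      | exact Or.inr (eq_of_inc_eq he ha (h.trans hw.symm))
  · rintro (rfl | rfl) h0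
    · rw [h0, zero_mul] at hvw; norm_num at hvw
    · rw [h0, mul_zero] at hvw; norm_num at hvw

/-- Two edges with the same end points are equal. -/
theorem edge_unique {v w e e' : K.Cell} (he : K.dim e = 1) (he' : K.dim e' = 1)
    (h : K.inc v e * K.inc w e = -1) (h' : K.inc v e' * K.inc w e' = -1) : e = e' := by
  refine K.eq_of_facets e e' he.ge ?_
  ext a
  simp only [Set.mem_ofPred_eq, facet_iff_of_edge he h, facet_iff_of_edge he' h']

theorem dim_le_one {G : CellComplex.{u}} (hG : G.dimension = 1) (y : G.Cell) : G.dim y ≤ 1 :=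
  hG ▸ Finset.le_sup (f := G.dim) (Finset.mem_univ y)

theorem dim_eq_of_facet {G : CellComplex.{u}} (hG : G.dimension = 1) {v e : G.Cell}
    (h : G.inc v e ≠ 0) : G.dim v = 0 ∧ G.dim e = 1 := by
  have h1 := G.dim_of_facet v e h
  have h2 := dim_le_one hG e
  omega

/-! ### Forman curvature in `K` is at most Ollivier curvature in `G`. -/

namespace IsSkeleton

variable {G : CellComplex.{u}} {ι : G.Cell → K.Cell} (hι : IsSkeleton 1 G K ι)
include hι

theorem sum_eq (F : K.Cell → ℝ) (hF : ∀ z, 2 ≤ K.dim z → F z = 0) :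
    ∑ z, F z = ∑ y, F (ι y) := by
  refine (Fintype.sum_of_injective ι hι.injective _ _ (fun z hz => hF z ?_) fun _ => rfl).symm
  rw [hι.range_eq, Set.mem_ofPred_eq] at hz
  omega

theorem δ_extend (hG : G.dimension = 1) (f : G.Cell → ℝ) :
    ∃ f' : K.Cell → ℝ, (∀ y, K.δ f' (ι y) = G.δ f y) ∧ ∀ z, 2 ≤ K.dim z → K.δ f' z = 0 := by
  -- Values of `f` on edges do not affect `δ f` in `G`, but would produce values on 2-cells of `K`;
  -- they are therefore set to zero.
  refine ⟨Function.extend ι (fun v => if G.dim v = 0 then f v else 0) 0, fun y => ?_, fun z hz => ?_⟩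
  · rw [K.δ_apply, G.δ_apply, hι.sum_eq]
    · refine Finset.sum_congr rfl fun v _ => ?_
      rw [hι.injective.extend_apply, hι.inc_eq]
      by_cases h : G.inc v y = 0
      · simp [h]
      · rw [if_pos (dim_eq_of_facet hG h).1]
    · intro z hz
      rw [Function.extend_apply', Pi.zero_apply, zero_mul]
      rintro ⟨v, rfl⟩
      have := hι.dim_eq v
      have := dim_le_one hG v
      omega
  · rw [K.δ_apply]
    refine Finset.sum_eq_zero fun v _ => ?_
    by_cases hv : ∃ w, ι w = v
    · obtain ⟨w, rfl⟩ := hv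
      rw [hι.injective.extend_apply]
      split_ifs with h
      · rw [K.inc_eq_zero_of_dim, mul_zero]
        rw [hι.dim_eq, h]; omega
      · rw [zero_mul]
    · rw [Function.extend_apply' _ _ _ hv, Pi.zero_apply, zero_mul]

theorem δ_δadj_eq (hG : G.dimension = 1) {x : G.Cell} (h : K.Cell → ℝ)
    (h0 : ∀ z, 2 ≤ K.dim z → h z = 0) :
    K.δ (K.δadj h) (ι x) = G.δ (G.δadj (h ∘ ι)) x := by
  rw [K.δ_apply, G.δ_apply, hι.sum_eq]
  · refine Finset.sum_congr rfl fun v _ => ?_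
    rw [hι.inc_eq, K.δadj_apply, G.δadj_apply, hι.sum_eq]
    · simp only [hι.m_eq, hι.inc_eq, Function.comp_apply]
    · intro z hz
      rw [h0 z hz, zero_mul, zero_mul]
  · intro z hz
    rw [K.inc_eq_zero_of_dim, mul_zero]
    have := dim_le_one hG x
    rw [hι.dim_eq]; omega

theorem forman_le_ollivier (hG : G.dimension = 1) (x : G.Cell) :
    ((K.forman (ι x) : ℝ) : EReal) ≤ G.ollivier x := by
  refine le_sInf ?_
  rintro r ⟨f, hfx, hf, rfl⟩
  obtain ⟨f', h1, h2⟩ := hι.δ_extend hG f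
  have hcomp : K.δ f' ∘ ι = G.δ f := funext h1
  rw [EReal.coe_le_coe_iff, ← hcomp, ← hι.δ_δadj_eq hG _ h2, ← K.hodge_δ]
  refine K.forman_le_hodge _ _ (by rw [h1, hfx]) fun z => ?_
  by_cases hz : 2 ≤ K.dim z
  · rw [h2 z hz]; simp
  · have : z ∈ Set.range ι := by
      rw [hι.range_eq, Set.mem_ofPred_eq]; omega
    obtain ⟨y, rfl⟩ := this
    rw [h1]
    exact hf y

end IsSkeleton

end CellComplex

/-! ### Oriented cycles through an edge. -/

namespace CellComplex

variable {G : CellComplex.{u}}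

/-- `c` is the indicator function of an oriented cycle in the graph `G` which passes through the
edge `x` in positive direction. -/
structure IsCycleVector (G : CellComplex.{u}) (x : G.Cell) (c : G.Cell → ℝ) : Prop where
  mem : ∀ y, c y = -1 ∨ c y = 0 ∨ c y = 1
  dim_eq : ∀ y, c y ≠ 0 → G.dim y = 1
  base : c x = 1
  /-- At every vertex on it, the cycle enters once and leaves once. -/
  diamond : ∀ v, {y | G.inc v y ≠ 0 ∧ c y ≠ 0}.Nonempty →
    {y | G.inc v y ≠ 0 ∧ c y ≠ 0}.ncard = 2 ∧
    ({-1, 1} : Set ℝ) ⊆ {r | ∃ y, r = G.inc v y * c y}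
  connected : ∀ y, c y ≠ 0 → Relation.ReflTransGen
    (fun a b => c a ≠ 0 ∧ c b ≠ 0 ∧ ∃ v, G.inc v a ≠ 0 ∧ G.inc v b ≠ 0) x y

namespace IsCycleVector

theorem sum_inc {x : G.Cell} {c : G.Cell → ℝ} (hc : G.IsCycleVector x c) (v : G.Cell) :
    ∑ y, G.inc v y * c y = 0 := by
  by_cases hne : {y | G.inc v y ≠ 0 ∧ c y ≠ 0}.Nonempty
  · obtain ⟨hcard, hsub⟩ := hc.diamond v hne
    exact sum_eq_zero_of_ncard_eq_two (fun x => mul_ne_zero_iff.symm) hcard hsub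
  · refine Finset.sum_eq_zero fun y _ => ?_
    by_contra h0
    exact hne ⟨y, mul_ne_zero_iff.1 h0⟩

/-- An oriented cycle through `x` is determined by its set of edges. -/
theorem eq_of_support {x : G.Cell} {c c' : G.Cell → ℝ} (hc : G.IsCycleVector x c)
    (hc' : G.IsCycleVector x c') (h : ∀ y, c y ≠ 0 ↔ c' y ≠ 0) : c = c' := by
  have key : ∀ y, c y ≠ 0 → c y = c' y := by
    intro y hy
    -- The sign at `x` is fixed; at each shared vertex the two incident cycle edges have opposite
    -- signed incidences, which carries the sign along the cycle.
    induction hc.connected y hy with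
    | refl => rw [hc.base, hc'.base]
    | @tail a b _ hab ih =>
      obtain ⟨ha, hb, v, hva, hvb⟩ := hab
      by_cases heq : a = b
      · exact heq ▸ ih ha
      have h1 := hc.diamond v ⟨a, hva, ha⟩
      have h2 := hc'.diamond v ⟨a, hva, (h a).1 ha⟩
      have e1 := (add_eq_zero_of_ncard_eq_two (fun x => mul_ne_zero_iff.symm) h1.1 h1.2 heq
        (mul_ne_zero hva ha) (mul_ne_zero hvb hb)).2
      have e2 := (add_eq_zero_of_ncard_eq_two (fun x => mul_ne_zero_iff.symm) h2.1 h2.2 heq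
        (mul_ne_zero hva ((h a).1 ha)) (mul_ne_zero hvb ((h b).1 hb))).2
      rw [← ih ha] at e2
      exact mul_left_cancel₀ hvb (by linarith)
  funext y
  by_cases hy : c y = 0
  · rw [hy]
    by_contra h0
    exact (h y).2 (Ne.symm h0) hy
  · exact key y hy

theorem finite (G : CellComplex.{u}) (x : G.Cell) : {c | G.IsCycleVector x c}.Finite := by
  refine (Set.Finite.pi' (fun _ : G.Cell => Set.toFinite ({-1, 0, 1} : Set ℝ))).subset ?_
  intro c hc y
  exact hc.mem y

end IsCycleVector

theorem inc_eq_neg_of_mul {v w e : G.Cell} (h : G.inc v e * G.inc w e = -1) :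
    G.inc v e = -G.inc w e ∧ G.inc v e ≠ 0 ∧ G.inc w e ≠ 0 ∧ G.inc w e * G.inc w e = 1 := by
  rcases G.inc_mem v e with hv | hv | hv <;> rcases G.inc_mem w e with hw | hw | hw <;>
    rw [hv, hw] at h <;> norm_num at h <;> rw [hv, hw] <;> norm_num

section Cycle

variable (hG : G.dimension = 1) {n : ℕ} (h1 : (1 : ZMod n) ≠ 0) (h2 : (2 : ZMod n) ≠ 0)
  {v e : ZMod n → G.Cell} (hv : Function.Injective v)
  (he : ∀ i, G.inc (v i) (e i) * G.inc (v (i + 1)) (e i) = -1)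

include hG he in
theorem facet_cycle_iff (a : G.Cell) (i : ZMod n) :
    G.inc a (e i) ≠ 0 ↔ a = v i ∨ a = v (i + 1) :=
  facet_iff_of_edge (dim_eq_of_facet hG (inc_eq_neg_of_mul (he i)).2.1).2 (he i) a

include hG hv he

include h2 in
-- An edge determines its pair of end points, so a coincidence `e i = e j` with `i ≠ j` would need
-- `i = j + 1` and `i + 1 = j`, hence `2 = 0`.
theorem injective_cycle_edges : Function.Injective e := by
  intro i j hij
  have hi := facet_cycle_iff hG he (v i) i
  have hi' := facet_cycle_iff hG he (v (i + 1)) i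
  rw [hij, facet_cycle_iff hG he] at hi hi'
  simp only [hv.eq_iff, true_or, or_true, iff_true] at hi hi'
  rcases hi with h | h
  · exact h
  rcases hi' with h' | h'
  · exact absurd (by linear_combination h' - h : (2 : ZMod n) = 0) h2
  · exact add_right_cancel h'

include h1 h2 in
theorem isCycleVector_extend [NeZero n] (h0 : G.inc (v 1) (e 0) = 1) :
    G.IsCycleVector (e 0) (Function.extend e (fun i => G.inc (v (i + 1)) (e i)) 0) := by
  have hinj := injective_cycle_edges hG h2 hv he
  set c := Function.extend e (fun i => G.inc (v (i + 1)) (e i)) 0 with hc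
  have hce : ∀ i, c (e i) = G.inc (v (i + 1)) (e i) := fun i => hinj.extend_apply _ _ i
  have hc0 : ∀ y, c y ≠ 0 → ∃ i, e i = y := fun y hy => by
    by_contra h
    exact hy (Function.extend_apply' _ _ _ h)
  have hne : ∀ i, c (e i) ≠ 0 := fun i => by
    rw [hce]; exact (inc_eq_neg_of_mul (he i)).2.2.1
  refine ⟨fun y => ?_, fun y hy => ?_, ?_, fun a => ?_, fun y hy => ?_⟩
  · by_cases hy : c y = 0
    · exact Or.inr (Or.inl hy)
    · obtain ⟨i, rfl⟩ := hc0 y hy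
      rw [hce]
      exact G.inc_mem _ _
  · obtain ⟨i, rfl⟩ := hc0 y hy
    exact (dim_eq_of_facet hG (inc_eq_neg_of_mul (he i)).2.1).2
  · rw [hce, zero_add, h0]
  · rintro ⟨y, hay, hy⟩
    obtain ⟨j, rfl⟩ : ∃ j, a = v (j + 1) := by
      obtain ⟨i, rfl⟩ := hc0 y hy
      rcases (facet_cycle_iff hG he a i).1 hay with rfl | rfl
      · exact ⟨i - 1, by rw [sub_add_cancel]⟩
      · exact ⟨i, rfl⟩
    have hset : {y | G.inc (v (j + 1)) y ≠ 0 ∧ c y ≠ 0} = {e j, e (j + 1)} := by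
      ext y
      constructor
      · rintro ⟨h, hy⟩
        obtain ⟨i, rfl⟩ := hc0 y hy
        rw [facet_cycle_iff hG he, hv.eq_iff, hv.eq_iff] at h
        rcases h with h | h
        · exact Or.inr (by rw [h]; rfl)
        · exact Or.inl (by rw [add_right_cancel h])
      · rintro (rfl | rfl)
        · exact ⟨(facet_cycle_iff hG he _ _).2 (Or.inr rfl), hne _⟩
        · exact ⟨(facet_cycle_iff hG he _ _).2 (Or.inl rfl), hne _⟩
    refine ⟨?_, ?_⟩
    · rw [hset, Set.ncard_pair]
      rw [hinj.ne_iff]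
      intro h
      exact h1 (by linear_combination -h)
    · rintro r (rfl | rfl)
      · exact ⟨e (j + 1), by rw [hce, he]⟩
      · exact ⟨e j, by rw [hce, (inc_eq_neg_of_mul (he j)).2.2.2]⟩
  · obtain ⟨i, rfl⟩ := hc0 y hy
    rw [← ZMod.natCast_zmod_val i]
    induction i.val with
    | zero => rw [Nat.cast_zero]
    | succ k ih =>
      refine ih.tail ⟨hne _, hne _, v (k + 1), ?_, ?_⟩
      · exact (facet_cycle_iff hG he _ _).2 (Or.inr rfl)
      · rw [Nat.cast_succ]
        exact (facet_cycle_iff hG he _ _).2 (Or.inl rfl)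

include h2 in
theorem sum_extend_cycle [NeZero n] (g : G.Cell → ℝ) :
    ∑ y, Function.extend e (fun i => G.inc (v (i + 1)) (e i)) 0 y * g y =
      ∑ i, G.inc (v (i + 1)) (e i) * g (e i) := by
  have hinj := injective_cycle_edges hG h2 hv he
  refine (Fintype.sum_of_injective e hinj _ _ (fun y hy => ?_) fun i => ?_).symm
  · rw [Function.extend_apply' _ _ _ hy, Pi.zero_apply, zero_mul]
  · rw [hinj.extend_apply]

end Cycle

end CellComplex

/-! ### Attaching weighted discs along cycles. -/

namespace CellComplex

variable (G : CellComplex.{u}) (x : G.Cell)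

noncomputable instance : Fintype {c // G.IsCycleVector x c} :=
  (IsCycleVector.finite G x).fintype

variable (w : {c // G.IsCycleVector x c} → ℝ)

/-- The incidence numbers of the complex which arises from `G` by attaching a disc to each cycle
of positive weight. -/
noncomputable def attachInc : G.Cell ⊕ {c // 0 < w c} → G.Cell ⊕ {c // 0 < w c} → ℝ
  | .inl a, .inl b => G.inc a b
  | .inl a, .inr c => c.1.1 a
  | .inr _, _ => 0

/-- The data of the complex which arises from `G` by attaching a disc to each cycle of positive
weight. -/
noncomputable abbrev attachData : CellData.{u} where
  Cell := G.Cell ⊕ {c // 0 < w c}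
  dim := Sum.elim G.dim fun _ => 2
  δ := Matrix.vecMulLinear (Matrix.of (G.attachInc x w))
  -- The factor `G.m x` cancels the quotient by `m x` in `δ*`, so that the disc enters the Laplacian
  -- at `x` with coefficient exactly `w c`.
  m := Sum.elim G.m fun c => w c.1 * G.m x

theorem attachData_inc (a b : (G.attachData x w).Cell) :
    (G.attachData x w).inc a b = G.attachInc x w a b := by
  exact congrFun (Matrix.single_one_vecMul a (Matrix.of (G.attachInc x w))) b

variable {G} (hG : G.dimension = 1) (hx : G.dim x = 1)

/-- The complex which arises from the graph `G` by attaching a disc to each cycle of positive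
weight. -/
noncomputable abbrev attach : CellComplex.{u} where
  toCellData := G.attachData x w
  m_pos := by
    rintro (a | c)
    · exact G.m_pos a
    · exact mul_pos c.2 (G.m_pos x)
  inc_mem a b := by
    rw [attachData_inc]
    rcases a with a | a
    · rcases b with b | c
      · exact G.inc_mem a b
      · exact c.1.2.mem a
    · exact Or.inr (Or.inl rfl)
  dim_of_facet a b h := by
    rw [CellData.Facet, attachData_inc] at h
    rcases a with a | a
    · rcases b with b | c
      · exact G.dim_of_facet a b h
      · exact congrArg (· + 1) (c.1.2.dim_eq a h).symm
    · exact absurd rfl h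
  exists_facet := by
    rintro (b | c) h
    · obtain ⟨a, ha⟩ := G.exists_facet b h
      exact ⟨.inl a, by rw [CellData.Facet, attachData_inc]; exact ha⟩
    · refine ⟨.inl x, ?_⟩
      rw [CellData.Facet, attachData_inc]
      change c.1.1 x ≠ 0
      rw [c.1.2.base]
      exact one_ne_zero
  edge := by
    rintro (b | c) h
    · have key : ∀ r : ℝ, r ≠ 0 →
          {a | (G.attachData x w).dim a = 0 ∧ (G.attachData x w).inc a (.inl b) = r} =
          Sum.inl '' {a | G.dim a = 0 ∧ G.inc a b = r} := by
        intro r hr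
        ext a
        rcases a with a | a
        · rw [Sum.inl_injective.mem_set_image, Set.mem_ofPred_eq, attachData_inc]
          rfl
        · simp only [Set.mem_ofPred_eq, attachData_inc, Set.mem_image, reduceCtorEq, and_false,
            exists_false, iff_false]
          exact fun h => hr h.2.symm
      rw [key 1 one_ne_zero, key (-1) (by norm_num), Set.ncard_image_of_injective _ Sum.inl_injective,
        Set.ncard_image_of_injective _ Sum.inl_injective]
      exact G.edge b h
    · exact absurd h (by change ¬ 2 = 1; norm_num)
  diamond := by
    rintro (v | v) (z | c) hdim hne
    · change G.dim z = G.dim v + 2 at hdim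
      have := dim_le_one hG z
      omega
    · have hset : {y | (G.attachData x w).Facet (.inl v) y ∧
          (G.attachData x w).Facet y (.inr c)} =
          Sum.inl '' {y | G.inc v y ≠ 0 ∧ c.1.1 y ≠ 0} := by
        ext y
        simp only [CellData.Facet, attachData_inc]
        rcases y with y | y
        · rw [Sum.inl_injective.mem_set_image]
          rfl
        · simp only [Set.mem_ofPred_eq, Set.mem_image, reduceCtorEq, and_false, exists_false,
            iff_false]
          exact fun h => h.2 rfl
      rw [hset] at hne ⊢
      rw [Set.ncard_image_of_injective _ Sum.inl_injective]
      obtain ⟨h1, h2⟩ := c.1.2.diamond v (Set.image_nonempty.1 hne)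
      refine ⟨h1, fun r hr => ?_⟩
      obtain ⟨y, hy⟩ := h2 hr
      refine ⟨.inl y, ?_⟩
      rw [attachData_inc, attachData_inc]
      exact hy
    all_goals
      obtain ⟨y, h1, -⟩ := hne
      rw [CellData.Facet, attachData_inc] at h1
      exact absurd rfl h1
  connected := by
    rintro (z | c) hz a b ha hb
    · have := dim_le_one hG z
      change 2 ≤ G.dim z at hz
      omega
    · rw [CellData.Facet, attachData_inc] at ha hb
      have hsymm : Std.Symm ((G.attachData x w).BoundaryAdj (.inr c)) :=
        ⟨fun _ _ h => ⟨h.2.1, h.1, by rw [add_comm]; exact h.2.2⟩⟩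
      have hface : ∀ y, c.1.1 y ≠ 0 → (G.attachData x w).Facet (.inl y) (.inr c) := fun y hy => by
        rw [CellData.Facet, attachData_inc]; exact hy
      have key : ∀ y, c.1.1 y ≠ 0 →
          Relation.ReflTransGen ((G.attachData x w).BoundaryAdj (.inr c)) (.inl x) (.inl y) := by
        intro y hy
        induction c.1.2.connected y hy with
        | refl => rfl
        | @tail y y' _ hyy' ih =>
          obtain ⟨hy, hy', v, hv, hv'⟩ := hyy'
          have hadj : ∀ y, c.1.1 y ≠ 0 → G.inc v y ≠ 0 →
              (G.attachData x w).BoundaryAdj (.inr c) (.inl v) (.inl y) := by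
            intro y hy hv
            have h0 := dim_eq_of_facet hG hv
            have hvy : (G.attachData x w).Facet (.inl v) (.inl y) := by
              rw [CellData.Facet, attachData_inc]; exact hv
            refine ⟨.tail (.single hvy) (hface y hy), .single (hface y hy), ?_⟩
            rw [attachData_inc, attachData_inc]
            change G.inc v y + G.inc y v ≠ 0
            rwa [G.inc_eq_zero_of_dim (v := y) (z := v) (by omega), add_zero]
          -- Incident faces differ in dimension, so the passage between consecutive edges goes
          -- through their common vertex.
          exact ((ih hy).tail (hsymm.symm _ _ (hadj y hy hv))).tail (hadj y' hy' hv')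
      rcases a with a | a
      · rcases b with b | b
        · exact (Std.Symm.symm _ _ (key a ha)).trans (key b hb)
        · exact absurd rfl hb
      · exact absurd rfl ha
  eq_of_facets := by
    have hinl : ∀ a b, (G.attachData x w).Facet (.inl a) (.inl b) ↔ G.Facet a b := fun a b => by
      rw [CellData.Facet, attachData_inc]; rfl
    have hinr : ∀ a c, (G.attachData x w).Facet (.inl a) (.inr c) ↔ c.1.1 a ≠ 0 := fun a c => by
      rw [CellData.Facet, attachData_inc]; rfl
    rintro (z | c) (z' | c') hz h
    · refine congrArg _ (G.eq_of_facets z z' hz ?_)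
      ext a
      have := Set.ext_iff.1 h (.inl a)
      simpa only [Set.mem_ofPred_eq, hinl] using this
    · exfalso
      have := (Set.ext_iff.1 h (.inl x)).2 ((hinr _ _).2 (by rw [c'.1.2.base]; exact one_ne_zero))
      have := G.dim_of_facet _ _ ((hinl _ _).1 this)
      have := dim_le_one hG z
      omega
    · exfalso
      have := (Set.ext_iff.1 h (.inl x)).1 ((hinr _ _).2 (by rw [c.1.2.base]; exact one_ne_zero))
      have := G.dim_of_facet _ _ ((hinl _ _).1 this)
      have := dim_le_one hG z'
      omega
    -- The facets give only the support of a cycle; since all cycles traverse `x` positively, the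
    -- orientation is determined too.
    · refine congrArg _ (Subtype.ext (Subtype.ext (c.1.2.eq_of_support c'.1.2 fun y => ?_)))
      have := Set.ext_iff.1 h (.inl y)
      simpa only [Set.mem_ofPred_eq, hinr] using this

theorem attach_inc (a b : (attach x w hG hx).Cell) :
    (attach x w hG hx).inc a b = G.attachInc x w a b :=
  attachData_inc G x w a b

theorem isSkeleton_attach : IsSkeleton 1 G (attach x w hG hx) Sum.inl where
  injective := Sum.inl_injective
  range_eq := by
    ext z
    rcases z with z | c
    · simp only [Set.mem_range, Set.mem_ofPred_eq]
      exact ⟨fun _ => dim_le_one hG z, fun _ => ⟨z, rfl⟩⟩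
    · simp only [Set.mem_range, Set.mem_ofPred_eq, reduceCtorEq, exists_false, false_iff]
      change ¬ 2 ≤ 1
      norm_num
  dim_eq _ := rfl
  inc_eq _ _ := attach_inc ..
  m_eq _ := rfl

theorem dimension_attach_le : (attach x w hG hx).dimension ≤ 2 := by
  refine Finset.sup_le ?_
  rintro (z | c) -
  · exact (dim_le_one hG z).trans one_le_two
  · exact le_rfl

/-- The Laplacian preserves dimension, so the discs do not enter the sum defining `F(x)` as cells of
their own. -/
theorem hodge_attach_inr (c : {c // 0 < w c}) :
    (attach x w hG hx).hodge (Pi.single (.inr c) 1) (.inl x) = 0 := by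
  rw [CellData.hodge_single, CellData.δ_δadj_single, Finset.sum_eq_zero, Finset.sum_eq_zero, add_zero]
  · intro z _
    rw [attach_inc]
    change 0 * _ * _ = (0 : ℝ)
    rw [zero_mul, zero_mul]
  · rintro v -
    rw [attach_inc, attach_inc]
    rcases v with v | v
    · change _ * c.1.1 v * G.inc v x = 0
      by_cases hv : c.1.1 v = 0
      · rw [hv, mul_zero, zero_mul]
      · have := c.1.2.dim_eq v hv
        rw [G.inc_eq_zero_of_dim (by omega), mul_zero]
    · exact mul_zero _

/-- The sign `c x = 1` drops out of the disc term, and cycles of weight zero, which get no disc, can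
be added to the sum freely. -/
theorem hodge_attach_inl (hw : ∀ c, 0 ≤ w c) (y : G.Cell) :
    (attach x w hG hx).hodge (Pi.single (.inl y) 1) (.inl x) =
      G.δ (G.δadj (Pi.single y 1)) x + ∑ c, w c * c.1 y := by
  have hcomp : (Pi.single (.inl y) 1 : (attach x w hG hx).Cell → ℝ) ∘ Sum.inl = Pi.single y 1 := by
    funext z
    by_cases h : z = y
    · subst h; simp
    · have h' : (Sum.inl z : (attach x w hG hx).Cell) ≠ Sum.inl y := fun e => h (Sum.inl_injective e)
      rw [Function.comp_apply, Pi.single_eq_of_ne h, Pi.single_eq_of_ne h']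
  rw [CellData.hodge_single, (isSkeleton_attach x w hG hx).δ_δadj_eq hG, hcomp]
  · congr 1
    have hsum : ∀ F : (attach x w hG hx).Cell → ℝ,
        ∑ z, F z = ∑ z, F (.inl z) + ∑ c, F (.inr c) := fun F => by
      rw [← Fintype.sum_sum_type]
    rw [hsum, Finset.sum_eq_zero, zero_add]
    · refine Fintype.sum_of_injective Subtype.val Subtype.val_injective _ _ (fun c hc => ?_) fun c => ?_
      · have : ¬ 0 < w c := fun h => hc ⟨⟨c, h⟩, rfl⟩
        rw [le_antisymm (not_lt.1 this) (hw c), zero_mul]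
      · rw [attach_inc, attach_inc]
        change c.1.1 y * (w c.1 * G.m x / G.m x) * c.1.1 x = _
        rw [c.1.2.base, mul_div_cancel_right₀ _ (G.m_pos x).ne']
        ring
    · intro z _
      rw [attach_inc x w hG hx (.inl x)]
      change _ * G.inc x z = 0
      have := dim_le_one hG z
      rw [G.inc_eq_zero_of_dim (by omega), mul_zero]
  · intro z hz
    refine Pi.single_eq_of_ne ?_ _
    rintro rfl
    have := dim_le_one hG y
    change 2 ≤ G.dim y at hz
    omega

/-- The Forman curvature of `x` in the complex obtained by attaching discs. -/
theorem exists_forman_attach_eq (hw : ∀ c, 0 ≤ w c) :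
    ∃ g : G.Cell → ℝ, g x = 1 ∧ (∀ y, |g y| ≤ 1) ∧ (attach x w hG hx).forman (.inl x) =
      ∑ y, g y * (G.δ (G.δadj (Pi.single y 1)) x + ∑ c, w c * c.1 y) := by
  obtain ⟨h, h1, h2, h3⟩ := (attach x w hG hx).exists_forman_eq_hodge (.inl x)
  refine ⟨fun y => h (.inl y), h1, fun y => h2 _, ?_⟩
  rw [← h3, CellData.apply_eq_sum_single,
    show ∀ F : (attach x w hG hx).Cell → ℝ, ∑ z, F z = ∑ z, F (.inl z) + ∑ c, F (.inr c) from
      fun F => by rw [← Fintype.sum_sum_type],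
    Finset.sum_eq_zero (s := (Finset.univ : Finset {c // 0 < w c})), add_zero]
  · simp only [hodge_attach_inl x w hG hx hw]
  · intro c _
    rw [hodge_attach_inr, mul_zero]

end CellComplex

/-! ### Lagrange multipliers from Sion's minimax theorem. -/

/-- Lagrange multipliers for the minimization of a linear functional on a compact convex set under
finitely many linear constraints which are strictly satisfied at some point. -/
theorem exists_lagrange_multipliers {E σ : Type*} [TopologicalSpace E] [AddCommGroup E] [Module ℝ E]
    [IsTopologicalAddGroup E] [ContinuousSMul ℝ E] [Fintype σ] {X : Set E} (hconv : Convex ℝ X)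
    (hcomp : IsCompact X) (A : E →L[ℝ] ℝ) (P : σ → E →L[ℝ] ℝ) {g₀ : E} (hg₀ : g₀ ∈ X)
    (hP : ∀ s, P s g₀ ≤ -1) :
    ∃ g ∈ X, ∃ w : σ → ℝ, (∀ s, 0 ≤ w s) ∧ (∀ s, P s g ≤ 0) ∧
      ∀ h ∈ X, A g ≤ A h + ∑ s, w s * P s h := by
  classical
  obtain ⟨a, ha, hmin⟩ := hcomp.exists_isMinOn ⟨g₀, hg₀⟩ A.continuous.continuousOn
  -- The strictly feasible point `g₀` bounds the total multiplier mass at a saddle point by `A g₀ -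
  -- A a`. The extra `1` keeps every multiplier strictly below the cap `R` of the compact box `Y`.
  set R : ℝ := A g₀ - A a + 1 with hR
  have hR0 : 0 < R := by linarith [isMinOn_iff.1 hmin g₀ hg₀]
  let Y : Set (σ → ℝ) := Set.Icc 0 fun _ => R
  have hY0 : (0 : σ → ℝ) ∈ Y := ⟨le_rfl, fun _ => hR0.le⟩
  obtain ⟨g, hg, w, hw, hsad⟩ := Sion.exists_isSaddlePointOn (X := X) (Y := Y)
    (f := fun h w => A h + ∑ s, w s * P s h) ⟨g₀, hg₀⟩ hconv hcomp
    (fun w _ => (Continuous.lowerSemicontinuous (by fun_prop)).lowerSemicontinuousOn _)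
    (fun w _ => ConvexOn.quasiconvexOn ⟨hconv, fun h _ h' _ p q _ _ _ => le_of_eq (by
      simp only [map_add, map_smul, smul_eq_mul, mul_add, Finset.sum_add_distrib, Finset.mul_sum]
      simp only [mul_left_comm]
      ring)⟩)
    (convex_Icc _ _) ⟨0, hY0⟩ isCompact_Icc
    (fun h _ => (Continuous.upperSemicontinuous (by fun_prop)).upperSemicontinuousOn _)
    (fun h _ => ConcaveOn.quasiconcaveOn ⟨convex_Icc _ _, fun w _ w' _ p q _ _ hpq => le_of_eq (by
      simp only [Pi.add_apply, Pi.smul_apply, smul_eq_mul, mul_add, add_mul, Finset.sum_add_distrib,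
        Finset.mul_sum, mul_assoc]
      linear_combination A h * hpq)⟩)
  have h0 : ∀ h ∈ X, A g ≤ A h + ∑ s, w s * P s h := fun h hh => by
    simpa using hsad h hh 0 hY0
  refine ⟨g, hg, w, hw.1, fun s => ?_, h0⟩
  have hwR : w s < R := by
    have h1 := h0 g₀ hg₀
    have h2 : ∑ s, w s * P s g₀ ≤ ∑ s, -w s := Finset.sum_le_sum fun s _ => by
      linarith [mul_le_mul_of_nonneg_left (hP s) (show 0 ≤ w s from hw.1 s)]
    have h3 : w s ≤ ∑ s, w s := Finset.single_le_sum (fun s _ => hw.1 s) (Finset.mem_univ s)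
    rw [Finset.sum_neg_distrib] at h2
    linarith [isMinOn_iff.1 hmin g hg]
  -- If `P s g` were positive, raising the `s`-th multiplier to `R` would increase the Lagrangian at
  -- `g`, against the saddle property.
  have hupd : Function.update w s R ∈ Y := by
    refine ⟨fun t => ?_, fun t => ?_⟩
    · by_cases h : t = s
      · subst h; simpa using hR0.le
      · simpa [h] using hw.1 t
    · by_cases h : t = s
      · subst h; simp
      · simpa [h] using hw.2 t
  have h1 := hsad g hg _ hupd
  dsimp only at h1
  rw [← Finset.add_sum_erase _ _ (Finset.mem_univ s),
    ← Finset.add_sum_erase _ (fun s => w s * P s g) (Finset.mem_univ s),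
    Finset.sum_congr rfl fun t ht => by
      rw [Function.update_of_ne (Finset.ne_of_mem_erase ht)], Function.update_self] at h1
  nlinarith

/-! ### Edge functions as antisymmetric functions of vertex pairs. -/

namespace CellComplex

variable {G : CellComplex.{u}}

/-- Adjacency of vertices in the graph `G`. -/
def vertexGraph (G : CellComplex.{u}) : SimpleGraph G.Cell where
  Adj v w := ∃ e, G.inc v e * G.inc w e = -1
  symm := ⟨fun v w ⟨e, he⟩ => ⟨e, by rw [mul_comm]; exact he⟩⟩
  loopless := ⟨fun v ⟨e, he⟩ => by nlinarith [mul_self_nonneg (G.inc v e)]⟩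

open Classical in
/-- The value of `g` on the edge from `v` to `w`. -/
noncomputable def edgeValue (g : G.Cell → ℝ) (v w : G.Cell) : ℝ :=
  ∑ e, if G.inc v e * G.inc w e = -1 then G.inc w e * g e else 0

theorem edgeValue_symm (g : G.Cell → ℝ) (v w : G.Cell) : edgeValue g w v = -edgeValue g v w := by
  rw [edgeValue, edgeValue, ← Finset.sum_neg_distrib]
  refine Finset.sum_congr rfl fun e _ => ?_
  rw [mul_comm (G.inc w e)]
  split_ifs with h
  · rw [(inc_eq_neg_of_mul h).1, neg_mul]
  · rw [neg_zero]

variable (hG : G.dimension = 1)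
include hG

theorem edgeValue_eq (g : G.Cell → ℝ) {v w e : G.Cell} (he : G.inc v e * G.inc w e = -1) :
    edgeValue g v w = G.inc w e * g e := by
  rw [edgeValue, Finset.sum_eq_single e, if_pos he]
  · intro e' _ hne
    refine if_neg fun he' => hne ?_
    exact edge_unique (dim_eq_of_facet hG (inc_eq_neg_of_mul he').2.1).2
      (dim_eq_of_facet hG (inc_eq_neg_of_mul he).2.1).2 he' he
  · simp

theorem edgeValue_le_one (g : G.Cell → ℝ) (hg : ∀ y, |g y| ≤ 1) (v w : G.Cell) :
    edgeValue g v w ≤ 1 := by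
  by_cases h : G.vertexGraph.Adj v w
  · obtain ⟨e, he⟩ := h
    rw [edgeValue_eq hG g he]
    refine (le_abs_self _).trans ?_
    rw [abs_mul]
    exact mul_le_one₀ (G.abs_inc_le _ _) (abs_nonneg _) (hg e)
  · rw [edgeValue, Finset.sum_eq_zero]
    · exact zero_le_one
    · exact fun e _ => if_neg fun he => h ⟨e, he⟩

theorem δ_edge (f : G.Cell → ℝ) {v w e : G.Cell} (he : G.inc v e * G.inc w e = -1) :
    G.δ f e = G.inc w e * (f w - f v) := by
  classical
  have hvw : v ≠ w := SimpleGraph.Adj.ne (G := G.vertexGraph) ⟨e, he⟩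
  have hdim := (dim_eq_of_facet hG (inc_eq_neg_of_mul he).2.1).2
  rw [G.δ_apply, ← Finset.sum_subset (Finset.subset_univ {v, w}), Finset.sum_pair hvw,
    (inc_eq_neg_of_mul he).1]
  · ring
  · intro a _ ha
    by_contra h
    have := (facet_iff_of_edge hdim he a).1 (right_ne_zero_of_mul h)
    exact ha (by simpa using this)

theorem exists_other_end {v e : G.Cell} (h : G.inc v e ≠ 0) :
    ∃ w, G.inc v e * G.inc w e = -1 := by
  have hdim := (dim_eq_of_facet hG h).2
  rcases G.inc_mem v e with hv | hv | hv
  · obtain ⟨w, hw⟩ := exists_inc_eq_one hdim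
    exact ⟨w, by rw [hv, hw]; norm_num⟩
  · exact absurd hv h
  · obtain ⟨w, hw⟩ := exists_inc_eq_neg_one hdim
    exact ⟨w, by rw [hv, hw]; norm_num⟩

theorem abs_δ_le_one {f : G.Cell → ℝ} (hf : ∀ v w, G.vertexGraph.Adj v w → f v - f w ≤ 1)
    (y : G.Cell) : |G.δ f y| ≤ 1 := by
  by_cases h : ∃ v, G.inc v y ≠ 0
  · obtain ⟨v, hv⟩ := h
    obtain ⟨w, hw⟩ := exists_other_end hG hv
    have hadj : G.vertexGraph.Adj v w := ⟨y, hw⟩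
    rw [δ_edge hG f hw, abs_mul]
    refine mul_le_one₀ (G.abs_inc_le _ _) (abs_nonneg _) (abs_le.2 ⟨?_, ?_⟩)
    · linarith [hf v w hadj]
    · exact hf w v hadj.symm
  · push Not at h
    rw [G.δ_apply, Finset.sum_eq_zero]
    · simp
    · intro v _
      rw [h v, mul_zero]

section Edge

variable {x x₀ x₁ : G.Cell} (hx₀ : G.inc x₀ x = -1) (hx₁ : G.inc x₁ x = 1)
include hx₀ hx₁

/-- Translates the constraints on cycle vectors into sums over cyclic vertex sequences, the form
used by the graph lemma. -/
theorem circulation_nonpos {g : G.Cell → ℝ}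
    (hg : ∀ c, G.IsCycleVector x c → ∑ y, c y * g y ≤ 0) {n : ℕ} [NeZero n]
    (h1 : (1 : ZMod n) ≠ 0) (h2 : (2 : ZMod n) ≠ 0) {v : ZMod n → G.Cell}
    (hv : Function.Injective v) (hadj : ∀ i, G.vertexGraph.Adj (v i) (v (i + 1)))
    (hv0 : v 0 = x₀) (hv1 : v 1 = x₁) : ∑ i, edgeValue g (v i) (v (i + 1)) ≤ 0 := by
  choose e he using hadj
  have hx : G.inc (v 0) x * G.inc (v (0 + 1)) x = -1 := by
    rw [zero_add, hv0, hv1, hx₀, hx₁]; norm_num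
  have he0 : e 0 = x := edge_unique (dim_eq_of_facet hG (inc_eq_neg_of_mul (he 0)).2.1).2
    (dim_eq_of_facet hG (inc_eq_neg_of_mul hx).2.1).2 (he 0) hx
  have hc := isCycleVector_extend hG h1 h2 hv he (by rw [he0, hv1, hx₁])
  rw [he0] at hc
  have := hg _ hc
  rw [sum_extend_cycle hG h2 hv he] at this
  refine le_of_eq_of_le (Finset.sum_congr rfl fun i _ => ?_) this
  exact edgeValue_eq hG g (he i)

/-- Here `δ δ* g (x) = δ* g (x₁) - δ* g (x₀)`. It decreases when the values of `g` directed out of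
`x₁` grow and those directed out of `x₀` shrink, and this is how `δ f` compares with `g`. -/
theorem exists_δ_dominated {g : G.Cell → ℝ} (hgx : g x = 1) (hg : ∀ y, |g y| ≤ 1)
    (hc : ∀ c, G.IsCycleVector x c → ∑ y, c y * g y ≤ 0) :
    ∃ f : G.Cell → ℝ, G.δ f x = 1 ∧ (∀ y, |G.δ f y| ≤ 1) ∧
      G.δ (G.δadj (G.δ f)) x ≤ G.δ (G.δadj g) x := by
  have hx : G.inc x₀ x * G.inc x₁ x = -1 := by rw [hx₀, hx₁]; norm_num
  have hadj : G.vertexGraph.Adj x₀ x₁ := ⟨x, hx⟩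
  obtain ⟨f, hf0, hf1, hlip, hu, hw⟩ := G.vertexGraph.exists_lipschitz_of_circulation_nonpos
    (edgeValue g) (edgeValue_symm g) (edgeValue_le_one hG g hg) hadj
    (by rw [edgeValue_eq hG g hx, hx₁, hgx, one_mul])
    (by
      intro u h1 h2
      -- `ZMod 3` unfolds to `Fin 3`, so the cycle can be given as an explicit vector; likewise for
      -- lengths four and five below.
      have := circulation_nonpos hG hx₀ hx₁ hc (n := 3) (by decide) (by decide)
        (v := (![x₀, x₁, u] : Fin 3 → G.Cell))
        (by
          have := hadj.ne; have := h1.ne; have := h2.ne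
          intro i j
          fin_cases i <;> fin_cases j <;>
            first | exact fun _ => rfl | simp_all [eq_comm])
        (by intro i; fin_cases i; exacts [hadj, h1, h2]) rfl rfl
      exact (Fin.sum_univ_three _).symm.trans_le this)
    (by
      intro u w hu0 hw1 h1 h2 h3
      have := circulation_nonpos hG hx₀ hx₁ hc (n := 4) (by decide) (by decide)
        (v := (![x₀, x₁, u, w] : Fin 4 → G.Cell))
        (by
          have := hadj.ne; have := h1.ne; have := h2.ne; have := h3.ne
          intro i j
          fin_cases i <;> fin_cases j <;>
            first | exact fun _ => rfl | simp_all [eq_comm])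
        (by intro i; fin_cases i; exacts [hadj, h1, h2, h3]) rfl rfl
      exact (Fin.sum_univ_four _).symm.trans_le this)
    (by
      intro u t w hu0 hw1 huw ht0 ht1 h1 h2 h3 h4
      have := circulation_nonpos hG hx₀ hx₁ hc (n := 5) (by decide) (by decide)
        (v := (![x₀, x₁, u, t, w] : Fin 5 → G.Cell))
        (by
          have := hadj.ne; have := h1.ne; have := h2.ne; have := h3.ne; have := h4.ne
          intro i j
          fin_cases i <;> fin_cases j <;>
            first | exact fun _ => rfl | simp_all [eq_comm])
        (by intro i; fin_cases i; exacts [hadj, h1, h2, h3, h4]) rfl rfl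
      exact (Fin.sum_univ_five _).symm.trans_le this)
  have hadj_mono : ∀ (v : G.Cell) (h h' : G.Cell → ℝ),
      (∀ y, G.inc v y ≠ 0 → h y * G.inc v y ≤ h' y * G.inc v y) → G.δadj h v ≤ G.δadj h' v := by
    intro v h h' hle
    rw [G.δadj_apply, G.δadj_apply]
    refine Finset.sum_le_sum fun y _ => ?_
    rw [mul_right_comm, mul_right_comm (h' y)]
    refine mul_le_mul_of_nonneg_right ?_ (div_pos (G.m_pos _) (G.m_pos _)).le
    by_cases hy : G.inc v y = 0
    · rw [hy, mul_zero, mul_zero]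
    · exact hle y hy
  refine ⟨f, ?_, abs_δ_le_one hG hlip, ?_⟩
  · rw [δ_edge hG f hx, hx₁, hf0, hf1]; norm_num
  · rw [δ_edge hG _ hx, δ_edge hG _ hx, hx₁, one_mul, one_mul]
    refine sub_le_sub (hadj_mono _ _ _ fun y hy => ?_) ?_
    · obtain ⟨u, hy'⟩ := exists_other_end hG hy
      have h1 := hu u ⟨y, hy'⟩
      obtain ⟨h3, -, -, h4⟩ := inc_eq_neg_of_mul hy'
      rw [edgeValue_eq hG g hy'] at h1
      rw [δ_edge hG f hy', hf1, h3]
      linear_combination h1 + (1 - f u) * h4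
    · have key : G.δadj (fun y => -G.δ f y) x₀ ≤ G.δadj (fun y => -g y) x₀ :=
        hadj_mono _ _ _ fun y hy => by
          obtain ⟨w, hy'⟩ := exists_other_end hG hy
          have h1 := hw w ⟨y, hy'⟩
          obtain ⟨h3, -, -, h4⟩ := inc_eq_neg_of_mul hy'
          rw [edgeValue_eq hG g hy'] at h1
          rw [δ_edge hG f hy', hf0, h3]
          linear_combination h1 + f w * h4
      have hneg : ∀ h : G.Cell → ℝ, G.δadj (fun y => -h y) x₀ = -G.δadj h x₀ := fun h => by
        rw [show (fun y => -h y) = -h from rfl, map_neg, Pi.neg_apply]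
      rw [hneg, hneg] at key
      linarith

/-- A bounded function on the edges with negative circulation along all cycles through `x`. -/
theorem exists_circulation_eq_neg_one : ∃ g : G.Cell → ℝ, (g x = 1 ∧ ∀ y, |g y| ≤ 1) ∧
    ∀ c, G.IsCycleVector x c → ∑ y, c y * g y = -1 := by
  have hx : G.inc x₀ x * G.inc x₁ x = -1 := by rw [hx₀, hx₁]; norm_num
  have h01 : x₀ ≠ x₁ := SimpleGraph.Adj.ne (G := G.vertexGraph) ⟨x, hx⟩
  -- Coboundaries have zero circulation, so only the subtracted indicator of `x` counts, giving
  -- `-1`. At `x` the value is `1 + 1 - 1`; elsewhere the bound holds because no other edge joins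
  -- `x₀` and `x₁`.
  refine ⟨fun y => G.inc x₁ y - G.inc x₀ y - (Pi.single x 1 : G.Cell → ℝ) y,
    ⟨by simp [hx₀, hx₁], fun y => ?_⟩, fun c hc => ?_⟩
  · by_cases hy : y = x
    · subst hy
      simp [hx₀, hx₁]
    dsimp only
    rw [Pi.single_eq_of_ne hy, sub_zero]
    by_cases h0 : G.inc x₀ y = 0
    · rw [h0, sub_zero]; exact G.abs_inc_le _ _
    by_cases h1 : G.inc x₁ y = 0
    · rw [h1, zero_sub, abs_neg]; exact G.abs_inc_le _ _
    have hdim := (dim_eq_of_facet hG h0).2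
    obtain ⟨w, hw⟩ := exists_other_end hG h0
    rcases (facet_iff_of_edge hdim hw x₁).1 h1 with h | rfl
    · exact absurd h.symm h01
    · exact absurd (edge_unique hdim (dim_eq_of_facet hG (inc_eq_neg_of_mul hx).2.1).2 hw hx) hy
  · have e0 := hc.sum_inc x₀
    have e1 := hc.sum_inc x₁
    have e2 : ∑ y, c y * (Pi.single x 1 : G.Cell → ℝ) y = 1 := by
      simp [Pi.single_apply, hc.base]
    simp only [mul_sub, Finset.sum_sub_distrib, e2, mul_comm (c _) (G.inc _ _), e0, e1]
    norm_num

end Edge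

theorem exists_ollivier_le_forman (x : G.Cell) (hx : G.dim x = 1) :
    ∃ (K : CellComplex.{u}) (ι : G.Cell → K.Cell), IsSkeleton 1 G K ι ∧ K.dimension ≤ 2 ∧
      G.ollivier x ≤ ((K.forman (ι x) : ℝ) : EReal) := by
  obtain ⟨x₀, hx₀⟩ := exists_inc_eq_neg_one hx
  obtain ⟨x₁, hx₁⟩ := exists_inc_eq_one hx
  obtain ⟨g₀, hg₀, hg₀c⟩ := exists_circulation_eq_neg_one hG hx₀ hx₁
  let X : Set (G.Cell → ℝ) := {g | g x = 1 ∧ ∀ y, |g y| ≤ 1}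
  have hX : X = {g | g x = 1} ∩ Set.Icc (-1) 1 := by
    ext g
    simp only [X, Set.mem_inter_iff, Set.mem_ofPred_eq, Set.mem_Icc, Pi.le_def, ← forall_and, abs_le]
    rfl
  have hconv : Convex ℝ X := by
    rw [hX]
    exact (convex_hyperplane (LinearMap.proj (R := ℝ) (φ := fun _ : G.Cell => ℝ) x).isLinear 1).inter
      (convex_Icc _ _)
  have hcomp : IsCompact X := by
    rw [hX]
    exact isCompact_Icc.inter_left (isClosed_eq (continuous_apply x) continuous_const)
  -- The multipliers `w` become the disc weights, and `hmin`, applied to the minimizing `h` of the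
  -- Forman curvature, bounds that curvature from below.
  obtain ⟨g, hg, w, hw0, hwP, hmin⟩ := exists_lagrange_multipliers hconv hcomp
    (LinearMap.toContinuousLinearMap (LinearMap.proj x ∘ₗ G.δ ∘ₗ G.δadj))
    (fun c : {c // G.IsCycleVector x c} => ∑ y, c.1 y • ContinuousLinearMap.proj y) hg₀
    (fun c => by simpa using (hg₀c c.1 c.2).le)
  obtain ⟨f, hfx, hf, hle⟩ := exists_δ_dominated hG hx₀ hx₁ hg.1 hg.2
    fun c hc => by simpa using hwP ⟨c, hc⟩
  refine ⟨attach x w hG hx, Sum.inl, isSkeleton_attach x w hG hx, dimension_attach_le x w hG hx, ?_⟩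
  have hκ : G.ollivier x ≤ ((G.δ (G.δadj (G.δ f)) x : ℝ) : EReal) := sInf_le ⟨f, hfx, hf, rfl⟩
  refine hκ.trans (EReal.coe_le_coe_iff.2 (hle.trans ?_))
  obtain ⟨h, hhx, hh, heq⟩ := exists_forman_attach_eq x w hG hx hw0
  rw [heq]
  refine (hmin h ⟨hhx, hh⟩).trans (le_of_eq ?_)
  have hA := G.apply_eq_sum_single (G.δ ∘ₗ G.δadj) h x
  simp only [LinearMap.comp_apply] at hA
  simp only [LinearMap.coe_toContinuousLinearMap', LinearMap.comp_apply, LinearMap.proj_apply,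
    sum_apply, smul_apply, ContinuousLinearMap.proj_apply,
    smul_eq_mul, hA, mul_add, Finset.sum_add_distrib, Finset.mul_sum]
  congr 1
  rw [Finset.sum_comm]
  refine Finset.sum_congr rfl fun y _ => Finset.sum_congr rfl fun c _ => ?_
  ring

end CellComplex

theorem mainTheorem1 (G : CellComplex.{u}) (hG : G.dimension = 1) (x : G.Cell)
    (hx : G.dim x = 1) :
    IsGreatest {r : EReal | ∃ (K : CellComplex.{u}) (ι : G.Cell → K.Cell),
        CellComplex.IsSkeleton 1 G K ι ∧ r = ((K.forman (ι x) : ℝ) : EReal)}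
      (G.ollivier x) ∧
    IsGreatest {r : EReal | ∃ (K : CellComplex.{u}) (ι : G.Cell → K.Cell),
        CellComplex.IsSkeleton 1 G K ι ∧ K.dimension ≤ 2 ∧
        r = ((K.forman (ι x) : ℝ) : EReal)}
      (G.ollivier x) := by
  obtain ⟨K, ι, hι, hdim, hle⟩ := CellComplex.exists_ollivier_le_forman hG x hx
  have heq := le_antisymm hle (hι.forman_le_ollivier hG x)
  refine ⟨⟨⟨K, ι, hι, heq⟩, ?_⟩, ⟨⟨K, ι, hι, hdim, heq⟩, ?_⟩⟩
  · rintro r ⟨K, ι, hι, rfl⟩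
    exact hι.forman_le_ollivier hG x
  · rintro r ⟨K, ι, hι, -, rfl⟩
    exact hι.forman_le_ollivier hG x
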